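/- All graphs are finite and simple. A set $D\subseteq V(H)$ is a dominating set of a graph $H$ if every vertex of $H$ lies in $D$ or is adjacent to a vertex of $D$, and a $\gamma$-set of $H$ is a dominating set of minimum cardinality. The $\gamma$-graph $H(\gamma)$ of $H$ has the $\gamma$-sets of $H$ as its vertices, and two $\gamma$-sets $D_1, D_2$ are adjacent in $H(\gamma)$ if there are $u\in D_1$ and $v\in D_2$ with $D_2=(D_1\setminus\{u\})\cup\{v\}$ and $uv\in E(H)$. A graph is called the $\gamma$-graph of a tree if it is isomorphic to $T(\gamma)$ for some tree $T$. **Theorem.** Let $G = G_1 \,\square\, G_2$ be the Cartesian product of two graphs $G_1$ and $G_2$, each with at least two vertices. Then $G$ is the $\gamma$-graph of a tree if and only if both $G_1$ and $G_2$ are $\gamma$-graphs of trees. -/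

import Mathlib

namespace GammaGraph

variable {V : Type*}

/-- `D` is a dominating set of `G`: every vertex lies in `D` or has a neighbour in `D`. -/
def IsDominating (G : SimpleGraph V) (D : Finset V) : Prop :=
  ∀ v, v ∈ D ∨ ∃ u ∈ D, G.Adj u v

/-- `D` is a `γ`-set of `G`: a dominating set of minimum cardinality. -/
def IsGammaSet (G : SimpleGraph V) (D : Finset V) : Prop :=
  IsDominating G D ∧ ∀ D' : Finset V, IsDominating G D' → D.card ≤ D'.card

/-- `D₂` is obtained from `D₁` by swapping a vertex `u ∈ D₁` for a vertex `v ∈ D₂` along an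
edge `uv` of `G`, i.e. `D₂ = (D₁ - {u}) ∪ {v}`. -/
def IsSwap [DecidableEq V] (G : SimpleGraph V) (D₁ D₂ : Finset V) : Prop :=
  ∃ u ∈ D₁, ∃ v ∈ D₂, D₂ = (D₁ \ {u}) ∪ {v} ∧ G.Adj u v

theorem IsSwap.symm_of_card_le [DecidableEq V] {G : SimpleGraph V} {D₁ D₂ : Finset V}
    (h : IsSwap G D₁ D₂) (hc : D₁.card ≤ D₂.card) : IsSwap G D₂ D₁ := by
  obtain ⟨u, hu, v, hv, rfl, huv⟩ := h
  have hne : u ≠ v := huv.ne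
  have hv1 : v ∉ D₁ := by
    intro hv1
    have hsub : (D₁ \ {u}) ∪ {v} ⊆ D₁.erase u := by
      intro x hx
      simp only [Finset.mem_union, Finset.mem_sdiff, Finset.mem_singleton] at hx
      rw [Finset.mem_erase]
      rcases hx with hx | rfl
      · exact ⟨hx.2, hx.1⟩
      · exact ⟨hne.symm, hv1⟩
    have h1 := Finset.card_le_card hsub
    have h2 := Finset.card_erase_lt_of_mem hu
    omega
  refine ⟨v, hv, u, hu, ?_, huv.symm⟩
  ext x
  simp only [Finset.mem_union, Finset.mem_sdiff, Finset.mem_singleton]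
  by_cases hxu : x = u
  · subst hxu; simp [hu]
  · by_cases hxv : x = v
    · subst hxv; simp [hv1, hxu]
    · simp [hxu, hxv]

/-- The `γ`-graph `G(γ)`: its vertices are the `γ`-sets of `G`, and two of them are adjacent
when one is obtained from the other by a swap along an edge of `G`. -/
def gammaGraph [DecidableEq V] (G : SimpleGraph V) :
    SimpleGraph {D : Finset V // IsGammaSet G D} where
  Adj D₁ D₂ := IsSwap G D₁.1 D₂.1
  symm := ⟨fun D₁ D₂ h => h.symm_of_card_le (D₁.2.2 _ D₂.2.1)⟩
  loopless := ⟨fun D h => by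
    obtain ⟨u, hu, v, _, hD, huv⟩ := h
    rw [hD] at hu
    simp [huv.ne] at hu⟩

/-- `G` is (isomorphic to) the `γ`-graph of some finite tree. -/
def IsGammaGraphOfTree (G : SimpleGraph V) : Prop :=
  ∃ (W : Type) (_ : Fintype W) (_ : DecidableEq W) (T : SimpleGraph W),
    T.IsTree ∧ Nonempty (G ≃g gammaGraph T)

end GammaGraph

/-! If both factors are γ-graphs of trees, both trees have more than one vertex, hence support
vertices. An edge joining support vertices does not affect domination, so the γ-sets of the joined
tree are the unions of γ-sets of the two trees, and its γ-graph is the product (`joinAtIso`).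

Conversely, a tree `T` has as many disjoint closed neighbourhoods N[s] as a γ-set has vertices, so a
γ-set is a choice of one vertex from each (`exists_packing`). A swap changes one of these
coordinates, and one of its two values is the centre s, as `T` has no triangle
(`exists_isStarCoords`). Opposite edges of a square of swaps therefore make the same change
(`IsStarCoords.square`). As T(γ) is connected, each coordinate depends on one factor only
(`IsStarCoords.forall_eq_or_forall_eq`). Prescribing the coordinates that depend on the second
factor cuts out a copy of the first; attaching leaves to the prescribed vertices forces them into
every γ-set (`addLeavesIso`). -/

namespace GammaGraph

/-! ### Rooted trees and parent maps -/

/-- `p` and `h` are the parent map and a height function of a rooting of `G` at `r`. -/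
structure IsRooting {V : Type*} (G : SimpleGraph V) (r : V) (p : V → V) (h : V → ℕ) : Prop where
  root : p r = r
  adj_parent : ∀ v, v ≠ r → G.Adj v (p v)
  parent_lt : ∀ v, v ≠ r → h (p v) < h v
  eq_or_eq_of_adj : ∀ u v, G.Adj u v → (u ≠ r ∧ p u = v) ∨ (v ≠ r ∧ p v = u)

theorem exists_isRooting {V : Type*} {G : SimpleGraph V} (hG : G.IsTree) (r : V) :
    ∃ p h, IsRooting G r p h := by
  choose w hw hu using fun v => hG.existsUnique_path r v
  have key : ∀ u v, G.Adj u v → G.dist r v = G.dist r u + 1 → v ≠ r ∧ (w v).penultimate = u := by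
    intro u v huv hd
    refine ⟨?_, ?_⟩
    · rintro rfl; simp at hd
    · obtain ⟨q, hq, hql⟩ := hG.connected.exists_path_of_dist r u
      have h1 : (q.concat huv).IsPath := by
        apply SimpleGraph.Walk.isPath_of_length_eq_dist
        simp [hql, hd]
      rw [← hu v _ h1]
      simp
  have h0 : ∀ v, v ≠ r → G.Adj v (w v).penultimate := fun v hv =>
    ((w v).adj_penultimate (SimpleGraph.Walk.not_nil_of_ne hv.symm)).symm
  have hroot : (w r).penultimate = r := by
    rw [← hu r .nil (by simp)]; simp
  refine ⟨fun v => (w v).penultimate, G.dist r, hroot, h0, ?_, ?_⟩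
  · intro v hv
    rcases hG.dist_eq_dist_add_one_of_adj r (h0 v hv) with h | h
    · omega
    · -- the parent of the parent would be `v`, making the shortest path too long
      exfalso
      obtain ⟨q, hq, hql⟩ := hG.connected.exists_path_of_dist r v
      rw [← hu v _ hq] at h
      have hn : ¬ q.Nil := SimpleGraph.Walk.not_nil_of_ne hv.symm
      have h2 := SimpleGraph.dist_le q.dropLast
      have h3 : q.dropLast.length ≤ q.length := by simp
      omega
  · intro u v huv
    rcases hG.dist_eq_dist_add_one_of_adj r huv with h | h
    · exact .inl (key v u huv.symm h)
    · exact .inr (key u v huv h)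

/-- Every edge joins some non-root vertex to its parent, so there are at most |V| - 1 edges. -/
theorem isTree_of_parent {V : Type*} [Finite V] {G : SimpleGraph V} (hG : G.Connected) (r : V)
    (p : V → V) (hp : ∀ u v, G.Adj u v → (u ≠ r ∧ p u = v) ∨ (v ≠ r ∧ p v = u)) :
    G.IsTree := by
  rw [SimpleGraph.isTree_iff_connected_and_card]
  refine ⟨hG, le_antisymm ?_ hG.card_vert_le_card_edgeSet_add_one⟩
  have h1 : G.edgeSet ⊆ (fun v => s(v, p v)) '' ({r}ᶜ : Set V) := by
    intro e
    induction e with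
    | h u v =>
      intro he
      rcases hp u v he with h | h
      · exact ⟨u, h.1, by rw [← h.2]⟩
      · exact ⟨v, h.1, by simp only [h.2]; exact Sym2.eq_swap⟩
  have h2 := Set.ncard_le_ncard h1 (Set.toFinite _)
  have h3 := Set.ncard_image_le (f := fun v => s(v, p v)) (Set.toFinite ({r}ᶜ : Set V))
  have h4 := Set.ncard_add_ncard_compl ({r} : Set V)
  rw [Set.ncard_singleton] at h4
  rw [← Nat.card_coe_set_eq] at h2
  omega

/-! ### Greedy packings and connectedness of the γ-graph -/

section Packing

variable {V : Type*} [DecidableEq V] {G : SimpleGraph V}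

theorem IsGammaSet.of_isSwap {D D' : Finset V} (hD : IsGammaSet G D) (hD' : IsDominating G D')
    (h : IsSwap G D D') : IsGammaSet G D' := by
  refine ⟨hD', fun E hE => le_trans ?_ (hD.2 E hE)⟩
  obtain ⟨u, hu, v, hv, rfl, huv⟩ := h
  refine (Finset.card_union_le _ _).trans ?_
  rw [Finset.card_sdiff_of_subset (by simpa using hu)]
  have := Finset.card_pos.2 ⟨u, hu⟩
  simp only [Finset.card_singleton]; omega

/-- Swapping a vertex of a `γ`-set along an edge gives a `γ`-set, provided that the private
neighbours of the vertex are dominated by the new vertex. -/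
theorem IsGammaSet.exists_swap {D : Finset V} (hD : IsGammaSet G D) {u v : V} (hu : u ∈ D)
    (huv : G.Adj u v)
    (hdom : ∀ x, G.Adj u x → x ≠ v → ∃ w ∈ D, w ≠ u ∧ (x = w ∨ G.Adj w x)) :
    ∃ D' : {D : Finset V // IsGammaSet G D},
      D'.1 = (D \ {u}) ∪ {v} ∧ (gammaGraph G).Adj ⟨D, hD⟩ D' := by
  have hs : IsSwap G D ((D \ {u}) ∪ {v}) := ⟨u, hu, v, by simp, rfl, huv⟩
  refine ⟨⟨_, hD.of_isSwap ?_ hs⟩, rfl, hs⟩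
  have aux : ∀ x, G.Adj u x →
      x ∈ (D \ {u}) ∪ {v} ∨ ∃ w ∈ (D \ {u}) ∪ {v}, G.Adj w x := by
    intro x hx
    by_cases hxv : x = v
    · left; simp [hxv]
    · obtain ⟨w, hw, hwu, rfl | hw'⟩ := hdom x hx hxv
      · left; simp [hw, hwu]
      · right; exact ⟨w, by simp [hw, hwu], hw'⟩
  intro x
  by_cases hxu : x = u
  · exact .inr ⟨v, by simp, hxu ▸ huv.symm⟩
  rcases hD.1 x with hx | ⟨w, hw, hwx⟩
  · left; simp [hx, hxu]
  · by_cases hwu : w = u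
    · exact aux x (hwu ▸ hwx)
    · exact .inr ⟨w, by simp [hw, hwu], hwx⟩

variable {r : V} {p : V → V} {h : V → ℕ}

/-- A stage of the greedy construction of a packing `S` whose set of parents dominates:
the closed neighbourhoods of the vertices of `S` are disjoint, no vertex not yet dominated is
higher than a vertex of `S`, and every `γ`-set can be reconfigured to one containing the parents
of the vertices of `S`. -/
structure IsStage (G : SimpleGraph V) (p : V → V) (h : V → ℕ) (S : Finset V) : Prop where
  packing : ∀ s ∈ S, ∀ t ∈ S, ∀ x, (x = s ∨ G.Adj x s) → (x = t ∨ G.Adj x t) → s = t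
  le_of_not_dominated : ∀ v, (∀ s ∈ S, v ≠ p s ∧ ¬ G.Adj (p s) v) → ∀ s ∈ S, h v ≤ h s
  reachable : ∀ D : {D : Finset V // IsGammaSet G D}, ∃ D' : {D : Finset V // IsGammaSet G D},
    (gammaGraph G).Reachable D D' ∧ S.image p ⊆ D'.1

/-- Since s is not higher than t, a path of length one or two from t to s starts with the step to `p
t`, so `p t` would dominate s. -/
theorem IsStage.packing_insert (hG : IsRooting G r p h) {S : Finset V} (hS : IsStage G p h S)
    {s : V} (hs : ∀ t ∈ S, s ≠ p t ∧ ¬ G.Adj (p t) s) :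
    ∀ t ∈ S, ∀ x, (x = s ∨ G.Adj x s) → ¬ (x = t ∨ G.Adj x t) := by
  intro t ht x hxs hxt
  have hle := hS.le_of_not_dominated s hs t ht
  obtain ⟨h1, h2⟩ := hs t ht
  have hpt : t ≠ r → G.Adj t (p t) := hG.adj_parent t
  have hst : s ≠ t := by
    rintro rfl
    by_cases hr : s = r
    · exact h1 (by rw [hr, hG.root])
    · exact h2 (hpt hr).symm
  have hadj : ¬ G.Adj s t := by
    intro hadj
    rcases hG.eq_or_eq_of_adj _ _ hadj with ⟨hr, e⟩ | ⟨hr, e⟩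
    · have := hG.parent_lt s hr
      rw [e] at this; omega
    · exact h1 e.symm
  rcases hxs with rfl | hxs
  · rcases hxt with rfl | hxt
    · exact hst rfl
    · exact hadj hxt
  rcases hxt with rfl | hxt
  · exact hadj hxs.symm
  rcases hG.eq_or_eq_of_adj _ _ hxt with ⟨hr, e⟩ | ⟨hr, e⟩
  · have hlt := hG.parent_lt x hr
    rcases hG.eq_or_eq_of_adj _ _ hxs with ⟨-, e'⟩ | ⟨hr', e'⟩
    · exact hst (e'.symm.trans e)
    · have := hG.parent_lt s hr'
      rw [e] at hlt; rw [e'] at this; omega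
  · exact h2 (e ▸ hxs)

/-- All vertices higher than s are already dominated by the parents of `S`. Hence a vertex
dominating s can be moved up to `p s`, first from a child to s if necessary: the neighbours it
leaves behind are higher than s, and the parents of `S` stay in place. -/
theorem IsStage.insert_of_max (hG : IsRooting G r p h) {S : Finset V} (hS : IsStage G p h S)
    {s : V} (hs : ∀ t ∈ S, s ≠ p t ∧ ¬ G.Adj (p t) s)
    (hmax : ∀ v, (∀ t ∈ S, v ≠ p t ∧ ¬ G.Adj (p t) v) → h v ≤ h s) :
    IsStage G p h (insert s S) where
  packing := by
    intro a ha b hb x hxa hxb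
    have := hS.packing_insert hG hs
    rw [Finset.mem_insert] at ha hb
    rcases ha with rfl | ha <;> rcases hb with rfl | hb
    · rfl
    · exact (this b hb x hxa hxb).elim
    · exact (this a ha x hxb hxa).elim
    · exact hS.packing a ha b hb x hxa hxb
  le_of_not_dominated := by
    intro v hv t ht
    have hv' : ∀ t ∈ S, v ≠ p t ∧ ¬ G.Adj (p t) v :=
      fun t ht => hv t (Finset.mem_insert_of_mem ht)
    rcases Finset.mem_insert.1 ht with rfl | ht
    · exact hmax v hv'
    · exact hS.le_of_not_dominated v hv' t ht
  reachable := by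
    -- vertices higher than `s` are dominated by the parents of `S`
    have hdom : ∀ D : Finset V, S.image p ⊆ D → ∀ u, (u = s ∨ G.Adj u s) → ∀ x, h s < h x →
        ∃ w ∈ D, w ≠ u ∧ (x = w ∨ G.Adj w x) := by
      intro D hSD u hu x hx
      by_contra hcon
      push Not at hcon
      refine absurd (hmax x fun t ht => ?_) (by omega)
      have htu : p t ≠ u := by
        rintro rfl
        rcases hu with hu | hu
        · exact (hs t ht).1 hu.symm
        · exact (hs t ht).2 hu
      exact hcon _ (hSD (Finset.mem_image_of_mem p ht)) htu
    have hnot : ∀ u, (u = s ∨ G.Adj u s) → u ∉ S.image p := by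
      intro u hu hmem
      obtain ⟨t, ht, rfl⟩ := Finset.mem_image.1 hmem
      rcases hu with hu | hu
      · exact (hs t ht).1 hu.symm
      · exact (hs t ht).2 hu
    have hkeep : ∀ D : Finset V, S.image p ⊆ D → ∀ u v, (u = s ∨ G.Adj u s) →
        S.image p ⊆ (D \ {u}) ∪ {v} := by
      intro D hSD u v hu x hx
      have : x ≠ u := by rintro rfl; exact hnot _ hu hx
      simp [hSD hx, this]
    have final : ∀ D : {D : Finset V // IsGammaSet G D}, S.image p ⊆ D.1 → p s ∈ D.1 →
        (insert s S).image p ⊆ D.1 := by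
      intro D hSD hps
      rw [Finset.image_insert]
      exact Finset.insert_subset hps hSD
    have hchild : ∀ x, G.Adj s x → x ≠ p s → h s < h x := by
      intro x hx hxp
      rcases hG.eq_or_eq_of_adj _ _ hx with ⟨_, e⟩ | ⟨hr, e⟩
      · exact absurd e.symm hxp
      · have := hG.parent_lt x hr
        rwa [e] at this
    have fromS : ∀ D : {D : Finset V // IsGammaSet G D}, S.image p ⊆ D.1 → s ∈ D.1 →
        ∃ D' : {D : Finset V // IsGammaSet G D},
          (gammaGraph G).Reachable D D' ∧ (insert s S).image p ⊆ D'.1 := by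
      intro D hSD hsD
      by_cases hr : s = r
      · exact ⟨D, .refl _, final D hSD (by rw [hr, hG.root, ← hr]; exact hsD)⟩
      · obtain ⟨D', hD', hadj⟩ := D.2.exists_swap hsD (hG.adj_parent s hr)
          fun x hx hxp => hdom D.1 hSD s (.inl rfl) x (hchild x hx hxp)
        refine ⟨D', hadj.reachable, final D' ?_ ?_⟩
        · rw [hD']; exact hkeep _ hSD _ _ (.inl rfl)
        · rw [hD']; simp
    intro D₀
    obtain ⟨D, hD₀, hSD⟩ := hS.reachable D₀
    rcases D.2.1 s with hsD | ⟨u, hu, hus⟩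
    · obtain ⟨D', h1, h2⟩ := fromS D hSD hsD
      exact ⟨D', hD₀.trans h1, h2⟩
    · by_cases hup : u = p s
      · exact ⟨D, hD₀, final D hSD (hup ▸ hu)⟩
      · have hlt := hchild u hus.symm hup
        obtain ⟨D', hD', hadj⟩ := D.2.exists_swap hu hus fun x hx hxs =>
          hdom D.1 hSD u (.inr hus) x (by
            rcases hG.eq_or_eq_of_adj _ _ hx with ⟨_, e⟩ | ⟨hr, e⟩
            · rcases hG.eq_or_eq_of_adj _ _ hus with ⟨_, e'⟩ | ⟨_, e'⟩
              · exact absurd (e.symm.trans e') hxs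
              · exact absurd e'.symm hup
            · have := hG.parent_lt x hr
              rw [e] at this; omega)
        obtain ⟨D'', h1, h2⟩ := fromS D' (by rw [hD']; exact hkeep _ hSD _ _ (.inr hus))
          (by rw [hD']; simp)
        exact ⟨D'', hD₀.trans (hadj.reachable.trans h1), h2⟩

theorem exists_isStage_dominating [Finite V] (hG : IsRooting G r p h) :
    ∃ S, IsStage G p h S ∧ IsDominating G (S.image p) := by
  classical
  have := Fintype.ofFinite V
  by_contra hcon
  push Not at hcon
  -- While the parents of `S` do not dominate, a highest undominated vertex can be added, so failure
  -- would give stages of every size.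
  have key : ∀ n, ∃ S, IsStage G p h S ∧ n ≤ S.card := by
    intro n
    induction n with
    | zero =>
      exact ⟨∅, ⟨by simp, by simp, fun D => ⟨D, .refl _, by simp⟩⟩, by simp⟩
    | succ n ih =>
      obtain ⟨S, hS, hn⟩ := ih
      have hnd := hcon S hS
      unfold IsDominating at hnd
      push Not at hnd
      obtain ⟨v, hv1, hv2⟩ := hnd
      obtain ⟨s, hs, hmax⟩ := Finset.exists_max_image
        (Finset.univ.filter fun v => ∀ t ∈ S, v ≠ p t ∧ ¬ G.Adj (p t) v) h
        ⟨v, by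
          simp only [Finset.mem_filter, Finset.mem_univ, true_and]
          exact fun t ht => ⟨fun e => hv1 (e ▸ Finset.mem_image_of_mem p ht),
            hv2 _ (Finset.mem_image_of_mem p ht)⟩⟩
      simp only [Finset.mem_filter, Finset.mem_univ, true_and] at hs hmax
      refine ⟨_, hS.insert_of_max hG hs hmax, ?_⟩
      rw [Finset.card_insert_of_notMem]
      · omega
      · exact fun hmem => hS.packing_insert hG hs s hmem s (.inl rfl) (.inl rfl)
  obtain ⟨S, -, hc⟩ := key (Fintype.card V + 1)
  have := S.card_le_univ
  omega

/-- The `γ`-graph of a tree is connected, and the tree has a packing of closed neighbourhoods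
such that every `γ`-set has exactly one vertex in each of them, and no other vertices. -/
theorem exists_packing [Finite V] (hG : G.IsTree) :
    (gammaGraph G).Preconnected ∧ ∃ S : Finset V,
      (∀ s ∈ S, ∀ t ∈ S, ∀ x, (x = s ∨ G.Adj x s) → (x = t ∨ G.Adj x t) → s = t) ∧
      ∀ D, IsGammaSet G D → ∃ f : S → V,
        (∀ s, f s = s ∨ G.Adj (f s) s) ∧ ∀ x, x ∈ D ↔ ∃ s, f s = x := by
  obtain ⟨r⟩ := hG.connected.nonempty
  obtain ⟨p, h, hp⟩ := exists_isRooting hG r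
  obtain ⟨S, hS, hdom⟩ := exists_isStage_dominating hp
  refine ⟨?_, S, hS.packing, ?_⟩
  -- All γ-sets reconfigure to the single γ-set `S.image p`.
  · have key : ∀ D, ∃ D' : {D : Finset V // IsGammaSet G D},
        (gammaGraph G).Reachable D D' ∧ D'.1 = S.image p := by
      intro D
      obtain ⟨D', h1, h2⟩ := hS.reachable D
      exact ⟨D', h1, (Finset.eq_of_subset_of_card_le h2 (D'.2.2 _ hdom)).symm⟩
    intro D E
    obtain ⟨D', h1, h2⟩ := key D
    obtain ⟨E', h3, h4⟩ := key E
    have : D' = E' := Subtype.ext (h2.trans h4.symm)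
    exact h1.trans (this ▸ h3.symm)
  · intro D hD
    have : ∀ s : S, ∃ x ∈ D, x = s.1 ∨ G.Adj x s := by
      intro s
      rcases hD.1 s with h | ⟨u, hu, h⟩
      · exact ⟨s, h, .inl rfl⟩
      · exact ⟨u, hu, .inr h⟩
    choose f hf hfs using this
    have hinj : Function.Injective f := by
      intro s t hst
      exact Subtype.ext (hS.packing s s.2 t t.2 (f s) (hfs s) (hst ▸ hfs t))
    refine ⟨f, hfs, ?_⟩
    have hsub : Finset.univ.image f ⊆ D := by
      intro x hx
      obtain ⟨s, -, rfl⟩ := Finset.mem_image.1 hx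
      exact hf s
    -- The parents of `S` dominate and number at most |S|, so `f` already exhausts `D`.
    have hcard : D.card ≤ (Finset.univ.image f).card := by
      rw [Finset.card_image_of_injective _ hinj, Finset.card_univ, Fintype.card_coe]
      exact (hD.2 _ hdom).trans Finset.card_image_le
    intro x
    rw [← Finset.eq_of_subset_of_card_le hsub hcard]
    simp

end Packing

/-! ### Star coordinates on Cartesian products -/

section Square

variable {V₁ V₂ ι W : Type*} {G₁ : SimpleGraph V₁} {G₂ : SimpleGraph V₂}

/-- Coordinates `f · i` on the vertices of a graph, such that the ends of each edge differ in
exactly one coordinate, where one of them takes a given central value. -/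
structure IsStarCoords {V : Type*} (G : SimpleGraph V) (c : ι → W) (f : V → ι → W) : Prop where
  injective : Function.Injective f
  adj : ∀ a b, G.Adj a b → ∃ i, (f a i = c i ∨ f b i = c i) ∧ ∀ j, f a j ≠ f b j ↔ j = i

theorem IsStarCoords.comp_iso {V V' : Type*} {G : SimpleGraph V} {G' : SimpleGraph V'} {c : ι → W}
    {f : V → ι → W} (hf : IsStarCoords G c f) (e : G' ≃g G) : IsStarCoords G' c (f ∘ e) :=
  ⟨hf.injective.comp e.injective, fun _ _ hab => hf.adj _ _ (e.map_rel_iff.2 hab)⟩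

/-- In a square all of whose edges change a single coordinate, opposite edges make
the same change. -/
theorem IsStarCoords.square {V : Type*} {G : SimpleGraph V} {c : ι → W} {f : V → ι → W}
    (hf : IsStarCoords G c f) {a b a' b' : V} (hab : G.Adj a b) (haa : G.Adj a a')
    (hbb : G.Adj b b') (hab' : G.Adj a' b') (hne : a ≠ b') (hne' : b ≠ a') {i : ι}
    (hi : f a i ≠ f b i) : f a' i = f a i ∧ f b' i = f b i := by
  obtain ⟨i₁, c₁, h₁⟩ := hf.adj _ _ hab
  obtain ⟨i₂, c₂, h₂⟩ := hf.adj _ _ haa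
  obtain ⟨i₃, c₃, h₃⟩ := hf.adj _ _ hbb
  obtain ⟨i₄, c₄, h₄⟩ := hf.adj _ _ hab'
  obtain ⟨k, hk⟩ := Function.ne_iff.1 (hf.injective.ne hne)
  obtain ⟨l, hl⟩ := Function.ne_iff.1 (hf.injective.ne hne')
  -- The edges at a cannot change the same coordinate: a would then carry its central value, b and
  -- a' would not, and b' would have to equal a. So they change different coordinates, and the
  -- diagonals, being nontrivial, force opposite edges to agree.
  grind

theorem IsStarCoords.eq_of_reachable {c : ι → W} {f : V₁ × V₂ → ι → W}
    (hf : IsStarCoords (G₁.boxProd G₂) c f) {x x' : V₁} (hx : G₁.Adj x x') {y y' : V₂}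
    (hy : G₂.Reachable y y') {i : ι} (hi : f (x, y) i ≠ f (x', y) i) :
    f (x, y') i = f (x, y) i ∧ f (x', y') i = f (x', y) i := by
  obtain ⟨w⟩ := hy
  induction w with
  | nil => exact ⟨rfl, rfl⟩
  | cons hadj w ih =>
    obtain ⟨h1, h2⟩ := hf.square (SimpleGraph.boxProd_adj_left.2 hx)
      (SimpleGraph.boxProd_adj_right.2 hadj) (SimpleGraph.boxProd_adj_right.2 hadj)
      (SimpleGraph.boxProd_adj_left.2 hx) (by simp [hx.ne]) (by simp [hx.ne']) hi
    rw [← h1, ← h2] at hi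
    rw [← h1, ← h2]
    exact ih hi

theorem exists_adj_ne_of_reachable {V α : Type*} {G : SimpleGraph V} (g : V → α) {x x' : V}
    (hx : G.Reachable x x') (hg : g x ≠ g x') : ∃ y y', G.Adj y y' ∧ g y ≠ g y' := by
  by_contra! hcon
  obtain ⟨w⟩ := hx
  induction w with
  | nil => exact hg rfl
  | cons hadj w ih => exact ih (hcon _ _ hadj ▸ hg)

/-- Each coordinate depends on only one factor of a connected Cartesian product. -/
theorem IsStarCoords.forall_eq_or_forall_eq {c : ι → W} {f : V₁ × V₂ → ι → W}
    (hf : IsStarCoords (G₁.boxProd G₂) c f) (h₁ : G₁.Preconnected) (h₂ : G₂.Preconnected) (i : ι) :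
    (∀ x y y', f (x, y) i = f (x, y') i) ∨ (∀ x x' y, f (x, y) i = f (x', y) i) := by
  by_contra! hcon
  obtain ⟨⟨x₀, y₀, y₀', hy₀⟩, x₁, x₁', y₁, hx₁⟩ := hcon
  obtain ⟨x, x', hx, hne⟩ := exists_adj_ne_of_reachable (fun x => f (x, y₁) i) (h₁ x₁ x₁') hx₁
  obtain ⟨y, y', hy, hne'⟩ := exists_adj_ne_of_reachable (fun y => f (x₀, y) i) (h₂ y₀ y₀') hy₀
  -- Moving both edges to the corner (x, y): coordinate i must change along yy' there, yet its value
  -- at x is the same over all of the second factor.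
  have hf' := hf.comp_iso (SimpleGraph.boxProdComm G₂ G₁)
  obtain ⟨h3, h4⟩ := hf'.eq_of_reachable hy (h₁ x₀ x) hne'
  have h5 := (hf.eq_of_reachable hx (h₂ y₁ y) hne).1
  have h6 := (hf.eq_of_reachable hx (h₂ y₁ y') hne).1
  exact hne' (h3.symm.trans ((h5.trans h6.symm).trans h4))

end Square

/-- The `γ`-graph of a tree has star coordinates that encode the elements of each `γ`-set. -/
theorem exists_isStarCoords {W : Type*} [Finite W] [DecidableEq W] {T : SimpleGraph W}
    (hT : T.IsTree) : ∃ (S : Finset W) (f : {D : Finset W // IsGammaSet T D} → S → W),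
      IsStarCoords (gammaGraph T) Subtype.val f ∧
      (∀ D x, x ∈ D.1 ↔ ∃ s, f D s = x) ∧ ∀ D E s t, f D s = f E t → s = t := by
  obtain ⟨-, S, hS, hf⟩ := exists_packing hT
  choose f hfs hmem using fun D : {D : Finset W // IsGammaSet T D} => hf D.1 D.2
  have hst : ∀ D E s t, f D s = f E t → s = t := fun D E s t h =>
    Subtype.ext (hS s s.2 t t.2 (f D s) (hfs D s) (h ▸ hfs E t))
  refine ⟨S, f, ⟨?_, ?_⟩, hmem, hst⟩
  · intro D E h
    apply Subtype.ext
    ext x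
    rw [hmem, hmem, h]
  · rintro D E ⟨u, hu, v, hv, hE, huv⟩
    obtain ⟨s, rfl⟩ := (hmem D u).1 hu
    obtain ⟨t, rfl⟩ := (hmem E v).1 hv
    have hE' : ∀ x, x ∈ E.1 ↔ (x ∈ D.1 ∧ x ≠ f D s) ∨ x = f E t := by
      intro x; rw [hE]; simp [or_comm]
    have hoff : ∀ j, j ≠ s → j ≠ t → f D j = f E j := by
      intro j hjs hjt
      have : f D j ∈ E.1 := (hE' _).2 (.inl ⟨(hmem D _).2 ⟨j, rfl⟩, fun e => hjs (hst _ _ _ _ e)⟩)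
      obtain ⟨k, hk⟩ := (hmem E _).1 this
      obtain rfl := hst _ _ _ _ hk
      exact hk.symm
    -- Otherwise the swap would leave N[s] without a vertex of `E`.
    have hts : s = t := by
      by_contra hne
      have : f E s ∈ E.1 := (hmem E _).2 ⟨s, rfl⟩
      rcases (hE' _).1 this with ⟨h1, h2⟩ | h
      · obtain ⟨k, hk⟩ := (hmem D _).1 h1
        obtain rfl := hst _ _ _ _ hk
        exact h2 hk.symm
      · exact hne (hst _ _ _ _ h)
    subst hts
    refine ⟨s, ?_, fun j => ⟨fun h => by_contra fun hj => h (hoff j hj hj), ?_⟩⟩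
    · by_contra! hcon
      have h1 := (hfs D s).resolve_left hcon.1
      have h2 := (hfs E s).resolve_left hcon.2
      -- otherwise there would be a triangle
      have h3 := hT.dist_eq_dist_add_one_of_adj s huv
      rw [SimpleGraph.dist_eq_one_iff_adj.2 h1.symm, SimpleGraph.dist_eq_one_iff_adj.2 h2.symm]
        at h3
      omega
    · rintro rfl; exact huv.ne

/-! ### Disjoint unions with cross edges -/

section CrossSum

variable {V W : Type*}

/-- The disjoint union of `G` and `H` together with the edges between them given by `R`. -/
def crossSum (G : SimpleGraph V) (H : SimpleGraph W) (R : V → W → Prop) :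
    SimpleGraph (V ⊕ W) where
  Adj
    | .inl u, .inl v => G.Adj u v
    | .inr u, .inr v => H.Adj u v
    | .inl u, .inr v => R u v
    | .inr v, .inl u => R u v
  symm := ⟨by
    rintro (u | u) (v | v) h
    exacts [SimpleGraph.Adj.symm (G := G) h, h, h, SimpleGraph.Adj.symm (G := H) h]⟩
  loopless := ⟨by
    rintro (u | u) h
    exacts [G.irrefl h, H.irrefl h]⟩

variable {G : SimpleGraph V} {H : SimpleGraph W} {R : V → W → Prop}

/-- The sum is connected if `G` is, and each component of `H` is attached to `G`. -/
theorem crossSum_connected (hG : G.Connected)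
    (hH : ∀ w, ∃ w' v, H.Reachable w w' ∧ R v w') : (crossSum G H R).Connected := by
  obtain ⟨r⟩ := hG.nonempty
  rw [SimpleGraph.connected_iff_exists_forall_reachable]
  have hl : ∀ v, (crossSum G H R).Reachable (.inl r) (.inl v) := fun v =>
    (hG.preconnected r v).map (⟨Sum.inl, fun h => h⟩ : G →g crossSum G H R)
  refine ⟨.inl r, ?_⟩
  rintro (v | w)
  · exact hl v
  · obtain ⟨w', v, h1, h2⟩ := hH w
    refine (hl v).trans ?_
    have h3 : (crossSum G H R).Adj (.inl v) (.inr w') := h2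
    exact h3.reachable.trans (h1.symm.map (⟨Sum.inr, fun h => h⟩ : H →g crossSum G H R))

variable [DecidableEq V] [DecidableEq W]

/-- A swap along a cross edge would change the sizes of both halves. -/
theorem isSwap_crossSum_iff {D₁ E₁ : Finset V} {D₂ E₂ : Finset W} (h₁ : D₁.card = E₁.card)
    (h₂ : D₂.card = E₂.card) :
    IsSwap (crossSum G H R) (D₁.disjSum D₂) (E₁.disjSum E₂) ↔
      (IsSwap G D₁ E₁ ∧ D₂ = E₂) ∨ (IsSwap H D₂ E₂ ∧ D₁ = E₁) := by
  constructor
  · rintro ⟨u | u, hu, v | v, hv, hE, huv⟩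
    · left
      have e1 := congrArg Finset.toLeft hE
      have e2 := congrArg Finset.toRight hE
      simp only [Finset.inl_mem_disjSum] at hu hv
      refine ⟨⟨u, hu, v, hv, ?_, huv⟩, ?_⟩
      · ext x; have := Finset.ext_iff.1 e1 x; simpa using this
      · ext x; have := Finset.ext_iff.1 e2 x; simpa using this.symm
    · exfalso
      have : E₁ ⊂ D₁ := by
        rw [Finset.ssubset_iff_of_subset]
        · refine ⟨u, by simpa using hu, fun h => ?_⟩
          have := Finset.ext_iff.1 hE (.inl u)
          simp [h] at this
        · intro x hx
          have := Finset.ext_iff.1 hE (.inl x)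
          simp [hx] at this
          exact this.1
      exact (Finset.card_lt_card this).ne h₁.symm
    · exfalso
      have : E₂ ⊂ D₂ := by
        rw [Finset.ssubset_iff_of_subset]
        · refine ⟨u, by simpa using hu, fun h => ?_⟩
          have := Finset.ext_iff.1 hE (.inr u)
          simp [h] at this
        · intro x hx
          have := Finset.ext_iff.1 hE (.inr x)
          simp [hx] at this
          exact this.1
      exact (Finset.card_lt_card this).ne h₂.symm
    · right
      have e1 := congrArg Finset.toLeft hE
      have e2 := congrArg Finset.toRight hE
      simp only [Finset.inr_mem_disjSum] at hu hv
      refine ⟨⟨u, hu, v, hv, ?_, huv⟩, ?_⟩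
      · ext x; have := Finset.ext_iff.1 e2 x; simpa using this
      · ext x; have := Finset.ext_iff.1 e1 x; simpa using this.symm
  · rintro (⟨⟨u, hu, v, hv, rfl, huv⟩, rfl⟩ | ⟨⟨u, hu, v, hv, rfl, huv⟩, rfl⟩)
    · refine ⟨.inl u, by simpa using hu, .inl v, by simp, ?_, huv⟩
      ext (x | x) <;> simp
    · refine ⟨.inr u, by simpa using hu, .inr v, by simp, ?_, huv⟩
      ext (x | x) <;> simp

end CrossSum

/-! ### Forcing vertices into every γ-set -/

section AddLeaves

variable {W : Type*}

/-- The graph obtained from `T` by attaching two leaves to each vertex of `A`. -/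
def addLeaves (T : SimpleGraph W) (A : Finset W) : SimpleGraph (W ⊕ A × Bool) :=
  crossSum T ⊥ fun u a => u = a.1

variable {T : SimpleGraph W} {A : Finset W}

theorem isTree_addLeaves [Finite W] (hT : T.IsTree) (A : Finset W) : (addLeaves T A).IsTree := by
  obtain ⟨r⟩ := hT.connected.nonempty
  obtain ⟨p, h, hp⟩ := exists_isRooting hT r
  refine isTree_of_parent (crossSum_connected hT.connected fun w => ⟨w, w.1, .refl _, rfl⟩)
    (.inl r) (Sum.elim (fun v => .inl (p v)) fun a => .inl a.1) ?_
  rintro (u | u) (v | v) huv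
  · simpa using hp.eq_or_eq_of_adj u v huv
  · right; exact ⟨by simp, congrArg Sum.inl (Eq.symm huv)⟩
  · left; exact ⟨by simp, congrArg Sum.inl (Eq.symm huv)⟩
  · exact huv.elim

theorem isDominating_addLeaves {E : Finset W} (hE : IsDominating T E) (hA : A ⊆ E) :
    IsDominating (addLeaves T A) (E.disjSum ∅) := by
  rintro (v | a)
  · rcases hE v with h | ⟨u, hu, huv⟩
    · left; simpa using h
    · exact .inr ⟨.inl u, by simpa using hu, huv⟩
  · exact .inr ⟨.inl a.1, by simpa using hA a.1.2, rfl⟩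

variable [DecidableEq W]

theorem isDominating_union_of_addLeaves {D : Finset (W ⊕ A × Bool)}
    (hD : IsDominating (addLeaves T A) D) : IsDominating T (D.toLeft ∪ A) := by
  intro v
  rcases hD (.inl v) with h | ⟨u | a, hu, huv⟩
  · left; simp [h]
  · exact .inr ⟨u, by simp [hu], huv⟩
  · left
    have : v = a.1 := huv
    simp [this]

/-- A vertex of `A` missing from `D` forces both its leaves into `D`, one more than the vertex
itself would cost. A single leaf would give no such surplus. -/
theorem card_of_isDominating_addLeaves {D : Finset (W ⊕ A × Bool)}
    (hD : IsDominating (addLeaves T A) D) :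
    (D.toLeft ∪ A).card + (A \ D.toLeft).card ≤ D.card ∧
      D.toLeft.card + D.toRight.card = D.card := by
  refine ⟨?_, Finset.card_toLeft_add_card_toRight⟩
  have h1 : ((A.attach.filter fun a => a.1 ∉ D.toLeft) ×ˢ (Finset.univ : Finset Bool)) ⊆
      D.toRight := by
    intro a ha
    simp only [Finset.mem_product, Finset.mem_filter, Finset.mem_attach, true_and,
      Finset.mem_univ, and_true, Finset.mem_toLeft] at ha
    rw [Finset.mem_toRight]
    rcases hD (.inr a) with h | ⟨u | b, hu, hub⟩
    · exact h
    · have : u = a.1 := hub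
      exact absurd (this ▸ hu) ha
    · exact hub.elim
  have h2 := Finset.card_le_card h1
  have h3 : (A.attach.filter fun a => a.1 ∉ D.toLeft).card = (A \ D.toLeft).card := by
    rw [← Finset.card_image_of_injective _ Subtype.val_injective]
    congr 1
    ext x
    simp [and_comm]
  rw [Finset.card_product, h3, Finset.card_univ, Fintype.card_bool] at h2
  have h4 := Finset.card_toLeft_add_card_toRight (u := D)
  have h5 : (D.toLeft ∪ A).card = D.toLeft.card + (A \ D.toLeft).card := by
    rw [← Finset.union_sdiff_self_eq_union, Finset.card_union_of_disjoint Finset.disjoint_sdiff]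
  omega

/-- If `A` is contained in a `γ`-set of `T`, the `γ`-sets of `addLeaves T A` are
the `γ`-sets of `T` that contain `A`. -/
theorem isGammaSet_addLeaves_iff {D₀ : Finset W} (hD₀ : IsGammaSet T D₀) (hA : A ⊆ D₀)
    {D : Finset (W ⊕ A × Bool)} :
    IsGammaSet (addLeaves T A) D ↔ D.toRight = ∅ ∧ IsGammaSet T D.toLeft ∧ A ⊆ D.toLeft := by
  constructor
  · intro hD
    have h1 := hD.2 _ (isDominating_addLeaves hD₀.1 hA)
    have h2 := isDominating_union_of_addLeaves hD.1
    have h3 := hD₀.2 _ h2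
    obtain ⟨h4, h5⟩ := card_of_isDominating_addLeaves hD.1
    rw [Finset.card_disjSum, Finset.card_empty] at h1
    have h6 : A ⊆ D.toLeft := by
      rw [← Finset.sdiff_eq_empty_iff_subset, ← Finset.card_eq_zero]; omega
    rw [Finset.union_eq_left.2 h6] at h2 h3
    refine ⟨?_, ⟨h2, fun E hE => ?_⟩, h6⟩
    · rw [← Finset.card_eq_zero]; omega
    · have := hD₀.2 _ hE
      omega
  · rintro ⟨h1, h2, h3⟩
    have hD : D = D.toLeft.disjSum ∅ := by rw [← h1, Finset.toLeft_disjSum_toRight]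
    refine ⟨hD ▸ isDominating_addLeaves h2.1 h3, fun E hE => ?_⟩
    have h4 := h2.2 _ (isDominating_union_of_addLeaves hE)
    have h5 := (card_of_isDominating_addLeaves hE).1
    rw [hD, Finset.card_disjSum, Finset.card_empty]
    omega

theorem IsGammaSet.card_eq {V : Type*} {G : SimpleGraph V} {D E : Finset V}
    (hD : IsGammaSet G D) (hE : IsGammaSet G E) : D.card = E.card :=
  le_antisymm (hD.2 _ hE.1) (hE.2 _ hD.1)

/-- The `γ`-graph of `addLeaves T A` is the subgraph of the `γ`-graph of `T` induced by
the `γ`-sets that contain `A`. -/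
def addLeavesIso {D₀ : Finset W} (hD₀ : IsGammaSet T D₀) (hA : A ⊆ D₀) :
    (gammaGraph T).induce {D | A ⊆ D.1} ≃g gammaGraph (addLeaves T A) where
  toFun D := ⟨D.1.1.disjSum ∅, (isGammaSet_addLeaves_iff hD₀ hA).2
    ⟨Finset.toRight_disjSum, by rw [Finset.toLeft_disjSum]; exact D.1.2,
      by rw [Finset.toLeft_disjSum]; exact D.2⟩⟩
  invFun D := ⟨⟨D.1.toLeft, ((isGammaSet_addLeaves_iff hD₀ hA).1 D.2).2.1⟩,
    ((isGammaSet_addLeaves_iff hD₀ hA).1 D.2).2.2⟩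
  left_inv D := Subtype.ext (Subtype.ext Finset.toLeft_disjSum)
  right_inv D := by
    apply Subtype.ext
    simp only
    rw [← ((isGammaSet_addLeaves_iff hD₀ hA).1 D.2).1, Finset.toLeft_disjSum_toRight]
  map_rel_iff' {D E} := by
    refine (isSwap_crossSum_iff (D.1.2.card_eq E.1.2) rfl).trans ?_
    constructor
    · rintro (h | ⟨⟨_, hu, _⟩, _⟩)
      · exact h.1
      · simp at hu
    · exact fun h => .inl ⟨h, rfl⟩

end AddLeaves

/-! ### Joining trees at support vertices -/

section Join

variable {V W : Type*} {T₁ : SimpleGraph V} {T₂ : SimpleGraph W} {x₁ : V} {x₂ : W}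

/-- `x` is a support vertex of `G`, i.e. a neighbour of a leaf. -/
def IsSupport {V : Type*} (G : SimpleGraph V) (x : V) : Prop :=
  ∃ l, ∀ u, G.Adj u l ↔ u = x

/-- The parent of a highest non-root vertex works, since that vertex is a leaf. -/
theorem exists_isSupport [Finite V] [Nontrivial V] (hT : T₁.IsTree) : ∃ x, IsSupport T₁ x := by
  classical
  have := Fintype.ofFinite V
  obtain ⟨r⟩ := hT.connected.nonempty
  obtain ⟨p, h, hp⟩ := exists_isRooting hT r
  obtain ⟨v, hv⟩ := exists_ne r
  obtain ⟨l, hl, hmax⟩ := Finset.exists_max_image (Finset.univ.filter fun v => v ≠ r) h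
    ⟨v, by simpa using hv⟩
  simp only [Finset.mem_filter, Finset.mem_univ, true_and] at hl hmax
  refine ⟨p l, l, fun u => ⟨fun hu => ?_, ?_⟩⟩
  · rcases hp.eq_or_eq_of_adj u l hu with ⟨h1, h2⟩ | ⟨h1, h2⟩
    · have h3 := hp.parent_lt u h1
      have h4 := hmax u h1
      rw [h2] at h3; omega
    · exact h2.symm
  · rintro rfl
    exact (hp.adj_parent l hl).symm

/-- A set that dominates all vertices, except possibly a support vertex, is dominating. -/
theorem IsSupport.isDominating {x : V} (hx : IsSupport T₁ x) {D : Finset V}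
    (hD : ∀ v, v ≠ x → v ∈ D ∨ ∃ u ∈ D, T₁.Adj u v) : IsDominating T₁ D := by
  obtain ⟨l, hl⟩ := hx
  intro v
  by_cases hv : v = x
  · subst hv
    have hadj : T₁.Adj v l := (hl v).2 rfl
    rcases hD l hadj.ne' with h | ⟨u, hu, hul⟩
    · exact .inr ⟨l, h, hadj.symm⟩
    · left; rwa [← (hl u).1 hul]
  · exact hD v hv

/-- The graph obtained from the disjoint union of `T₁` and `T₂` by adding the edge `x₁x₂`. -/
def joinAt (T₁ : SimpleGraph V) (T₂ : SimpleGraph W) (x₁ : V) (x₂ : W) : SimpleGraph (V ⊕ W) :=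
  crossSum T₁ T₂ fun u v => u = x₁ ∧ v = x₂

theorem isTree_joinAt [Finite V] [Finite W] (h₁ : T₁.IsTree) (h₂ : T₂.IsTree) (x₁ : V) (x₂ : W) :
    (joinAt T₁ T₂ x₁ x₂).IsTree := by
  classical
  obtain ⟨p, h, hp⟩ := exists_isRooting h₁ x₁
  obtain ⟨q, k, hq⟩ := exists_isRooting h₂ x₂
  refine isTree_of_parent (crossSum_connected h₁.connected fun w =>
      ⟨x₂, x₁, h₂.connected.preconnected _ _, rfl, rfl⟩) (.inl x₁)
    (Sum.elim (fun v => .inl (p v)) fun w => if w = x₂ then .inl x₁ else .inr (q w)) ?_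
  rintro (u | u) (v | v) huv
  · simpa using hp.eq_or_eq_of_adj u v huv
  · obtain ⟨rfl, rfl⟩ := huv
    right; simp
  · obtain ⟨rfl, rfl⟩ := huv
    left; simp
  · rcases hq.eq_or_eq_of_adj u v huv with ⟨h1, h2⟩ | ⟨h1, h2⟩
    · left; simp [h1, h2]
    · right; simp [h1, h2]

/-- Only x₁ and x₂ can gain a dominator from the other side, and each is dominated on its own side
anyway because its leaf is. -/
theorem isDominating_joinAt_iff (h₁ : IsSupport T₁ x₁) (h₂ : IsSupport T₂ x₂)
    {D : Finset (V ⊕ W)} : IsDominating (joinAt T₁ T₂ x₁ x₂) D ↔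
      IsDominating T₁ D.toLeft ∧ IsDominating T₂ D.toRight := by
  constructor
  · intro hD
    refine ⟨h₁.isDominating fun v hv => ?_, h₂.isDominating fun v hv => ?_⟩
    · rcases hD (.inl v) with h | ⟨u | u, hu, huv⟩
      · left; simpa using h
      · exact .inr ⟨u, by simpa using hu, huv⟩
      · exact absurd huv.1 hv
    · rcases hD (.inr v) with h | ⟨u | u, hu, huv⟩
      · left; simpa using h
      · exact absurd huv.2 hv
      · exact .inr ⟨u, by simpa using hu, huv⟩
  · rintro ⟨hl, hr⟩ (v | v)
    · rcases hl v with h | ⟨u, hu, huv⟩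
      · left; simpa using h
      · exact .inr ⟨.inl u, by simpa using hu, huv⟩
    · rcases hr v with h | ⟨u, hu, huv⟩
      · left; simpa using h
      · exact .inr ⟨.inr u, by simpa using hu, huv⟩

theorem isGammaSet_joinAt_iff (h₁ : IsSupport T₁ x₁) (h₂ : IsSupport T₂ x₂)
    {D : Finset (V ⊕ W)} : IsGammaSet (joinAt T₁ T₂ x₁ x₂) D ↔
      IsGammaSet T₁ D.toLeft ∧ IsGammaSet T₂ D.toRight := by
  unfold IsGammaSet
  simp only [isDominating_joinAt_iff h₁ h₂, ← Finset.card_toLeft_add_card_toRight (u := D)]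
  constructor
  · rintro ⟨⟨hl, hr⟩, hmin⟩
    refine ⟨⟨hl, fun E hE => ?_⟩, hr, fun E hE => ?_⟩
    · have := hmin (E.disjSum D.toRight) (by simp [hE, hr])
      rw [Finset.card_disjSum] at this; omega
    · have := hmin (D.toLeft.disjSum E) (by simp [hE, hl])
      rw [Finset.card_disjSum] at this; omega
  · rintro ⟨⟨hl, hl'⟩, hr, hr'⟩
    refine ⟨⟨hl, hr⟩, fun E hE => ?_⟩
    rw [← Finset.card_toLeft_add_card_toRight (u := E)]
    exact add_le_add (hl' _ hE.1) (hr' _ hE.2)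

variable [DecidableEq V] [DecidableEq W]

/-- Joining two graphs at support vertices multiplies their `γ`-graphs. -/
def joinAtIso (h₁ : IsSupport T₁ x₁) (h₂ : IsSupport T₂ x₂) :
    (gammaGraph T₁).boxProd (gammaGraph T₂) ≃g gammaGraph (joinAt T₁ T₂ x₁ x₂) where
  toFun D := ⟨D.1.1.disjSum D.2.1, (isGammaSet_joinAt_iff h₁ h₂).2
    ⟨by simpa using D.1.2, by simpa using D.2.2⟩⟩
  invFun D := (⟨D.1.toLeft, ((isGammaSet_joinAt_iff h₁ h₂).1 D.2).1⟩,
    ⟨D.1.toRight, ((isGammaSet_joinAt_iff h₁ h₂).1 D.2).2⟩)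
  left_inv D := by simp
  right_inv D := by simp [Finset.toLeft_disjSum_toRight]
  map_rel_iff' {D E} := by
    refine (isSwap_crossSum_iff (D.1.2.card_eq E.1.2) (D.2.2.card_eq E.2.2)).trans ?_
    rw [SimpleGraph.boxProd_adj, Subtype.ext_iff, Subtype.ext_iff]
    rfl

end Join

/-! ### The two directions of the theorem -/

theorem IsGammaGraphOfTree.of_iso {V V' : Type*} {G : SimpleGraph V} {G' : SimpleGraph V'}
    (h : IsGammaGraphOfTree G) (e : G' ≃g G) : IsGammaGraphOfTree G' := by
  obtain ⟨W, hf, hd, T, hT, ⟨e'⟩⟩ := h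
  exact ⟨W, hf, hd, T, hT, ⟨e.trans e'⟩⟩

/-- All γ-sets have the same size, so at most one vertex allows only one γ-set. This supplies the
support vertices needed for joining. -/
theorem nontrivial_of_gammaGraph {V W : Type*} [Nontrivial V] [DecidableEq W] {T : SimpleGraph W}
    {G : SimpleGraph V} (e : G ≃g gammaGraph T) : Nontrivial W := by
  by_contra hW
  rw [not_nontrivial_iff_subsingleton] at hW
  have := e.toEquiv.symm.nontrivial
  obtain ⟨D, E, hne⟩ := this
  apply hne
  have hc := D.2.card_eq E.2
  apply Subtype.ext
  rcases D.1.eq_empty_or_nonempty with h | ⟨x, hx⟩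
  · rw [h, Finset.card_empty] at hc
    rw [h, Finset.card_eq_zero.1 hc.symm]
  · obtain ⟨y, hy⟩ : E.1.Nonempty := by
      rw [← Finset.card_pos, ← hc]; exact Finset.card_pos.2 ⟨x, hx⟩
    ext z
    rw [Subsingleton.elim z x]
    exact iff_of_true hx (Subsingleton.elim y x ▸ hy)

theorem IsGammaGraphOfTree.boxProd {V₁ V₂ : Type*} [Nontrivial V₁] [Nontrivial V₂]
    {G₁ : SimpleGraph V₁} {G₂ : SimpleGraph V₂} (h₁ : IsGammaGraphOfTree G₁)
    (h₂ : IsGammaGraphOfTree G₂) : IsGammaGraphOfTree (G₁.boxProd G₂) := by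
  obtain ⟨W₁, _, _, T₁, hT₁, ⟨e₁⟩⟩ := h₁
  obtain ⟨W₂, _, _, T₂, hT₂, ⟨e₂⟩⟩ := h₂
  have := nontrivial_of_gammaGraph e₁
  have := nontrivial_of_gammaGraph e₂
  obtain ⟨x₁, hx₁⟩ := exists_isSupport hT₁
  obtain ⟨x₂, hx₂⟩ := exists_isSupport hT₂
  have e : G₁.boxProd G₂ ≃g (gammaGraph T₁).boxProd (gammaGraph T₂) :=
    ⟨e₁.toEquiv.prodCongr e₂.toEquiv, by
      intro a b
      exact or_congr (and_congr e₁.map_adj_iff e₂.injective.eq_iff)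
        (and_congr e₂.map_adj_iff e₁.injective.eq_iff)⟩
  exact ⟨W₁ ⊕ W₂, inferInstance, inferInstance, _, isTree_joinAt hT₁ hT₂ x₁ x₂,
    ⟨e.trans (joinAtIso hx₁ hx₂)⟩⟩

theorem IsGammaGraphOfTree.of_boxProd_left {V₁ V₂ : Type*} [Nonempty V₁] [Nonempty V₂]
    {G₁ : SimpleGraph V₁} {G₂ : SimpleGraph V₂} (h : IsGammaGraphOfTree (G₁.boxProd G₂)) :
    IsGammaGraphOfTree G₁ := by
  classical
  obtain ⟨W, _, _, T, hT, ⟨e⟩⟩ := h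
  have hconn : (G₁.boxProd G₂).Preconnected := e.preconnected_iff.2 (exists_packing hT).1
  obtain ⟨S, f, hf, hmem, hst⟩ := exists_isStarCoords hT
  have hor := (hf.comp_iso e).forall_eq_or_forall_eq hconn.ofBoxProdLeft hconn.ofBoxProdRight
  simp only [Function.comp_apply] at hor
  obtain ⟨x₀⟩ := ‹Nonempty V₁›
  obtain ⟨y₀⟩ := ‹Nonempty V₂›
  -- the vertices of `e (x₀, y₀)` in the coordinates that depend on the second factor
  let K : Finset S := Finset.univ.filter fun i => ¬ ∀ x y y', f (e (x, y)) i = f (e (x, y')) i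
  let A : Finset W := K.image (f (e (x₀, y₀)))
  have hK : ∀ i, i ∈ K → ∀ x x' y, f (e (x, y)) i = f (e (x', y)) i := by
    intro i hi
    exact (hor i).resolve_left (Finset.mem_filter.1 hi).2
  -- A vertex determines the coordinate it belongs to, so containing `A` fixes all coordinates in
  -- `K`. The others do not depend on y, whence e (x, y) = e (x, y₀).
  have hA : ∀ x y, A ⊆ (e (x, y)).1 ↔ y = y₀ := by
    intro x y
    constructor
    · intro hsub
      have : e (x, y) = e (x, y₀) := by
        apply hf.injective
        funext i
        by_cases hi : i ∈ K
        · obtain ⟨j, hj⟩ := (hmem _ _).1 (hsub (Finset.mem_image_of_mem _ hi))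
          obtain rfl := hst _ _ _ _ hj
          rw [hj]
          exact hK _ hi _ _ _
        · have : ∀ x y y', f (e (x, y)) i = f (e (x, y')) i := by
            simpa [K] using hi
          exact this _ _ _
      exact (Prod.ext_iff.1 (e.injective this)).2
    · rintro rfl a ha
      obtain ⟨i, hi, rfl⟩ := Finset.mem_image.1 ha
      exact (hmem _ _).2 ⟨i, hK i hi _ _ _⟩
  have e' : G₁ ≃g (gammaGraph T).induce {D | A ⊆ D.1} :=
    { toFun := fun x => ⟨e (x, y₀), (hA x y₀).2 rfl⟩
      invFun := fun D => (e.symm D.1).1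
      left_inv := fun x => by simp
      right_inv := fun D => by
        apply Subtype.ext
        have h1 := (hA (e.symm D.1).1 (e.symm D.1).2).1 
          (by rw [Prod.mk.eta, e.apply_symm_apply]; exact D.2)
        change e ((e.symm D.1).1, y₀) = D.1
        rw [← h1]; simp
      map_rel_iff' := fun {x x'} => by
        change (gammaGraph T).Adj (e (x, y₀)) (e (x', y₀)) ↔ _
        rw [SimpleGraph.Iso.map_adj_iff, SimpleGraph.boxProd_adj_left] }
  exact ⟨W ⊕ A × Bool, inferInstance, inferInstance, _, isTree_addLeaves hT A,
    ⟨e'.trans (addLeavesIso (e (x₀, y₀)).2 ((hA x₀ y₀).2 rfl))⟩⟩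

end GammaGraph

theorem mainTheorem2 {V V₁ V₂ : Type*} [Finite V₁] [Finite V₂] [Nontrivial V₁] [Nontrivial V₂]
    (G : SimpleGraph V) (G₁ : SimpleGraph V₁) (G₂ : SimpleGraph V₂)
    (hG : Nonempty (G ≃g G₁.boxProd G₂)) :
    GammaGraph.IsGammaGraphOfTree G ↔
      GammaGraph.IsGammaGraphOfTree G₁ ∧ GammaGraph.IsGammaGraphOfTree G₂ := by
  obtain ⟨e⟩ := hG
  constructor
  · intro h
    have h' := h.of_iso e.symm
    exact ⟨h'.of_boxProd_left, (h'.of_iso (SimpleGraph.boxProdComm G₂ G₁)).of_boxProd_left⟩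
  · rintro ⟨h₁, h₂⟩
    exact (h₁.boxProd h₂).of_iso e
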